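/- Let $\mathbb F\in\{\mathbb R,\mathbb C\}$, with $\star$ denoting the (conjugate) transpose, and let $E,Q,L\in\mathbb F^{n,n}$ satisfy $E^\star Q=Q^\star E\ge 0$ and $L+L^\star\le 0$. Assume that the pencil $P(\lambda)=\lambda E-LQ$ is regular, i.e. $\det P(\lambda_0)\ne 0$ for some $\lambda_0\in\mathbb C$, and of index at most one, i.e. all blocks for the eigenvalue $\infty$ in its Kronecker canonical form over $\mathbb C$ have size at most one. Let $n=n_1+n_2+n_3+n_4$ be a partition, with $n_i\ge 0$, and let $\widetilde U\in\mathbb F^{n,n}$ be unitary and $\widetilde X\in\mathbb F^{n,n}$ be invertible such that, partitioned conformably with $(n_1,n_2,n_3,n_4)$, $$\widetilde Q:=\widetilde UQ\widetilde X=\begin{pmatrix}Q_{11}&Q_{12}&0&0\\Q_{21}&Q_{22}&0&0\\0&0&0&0\\Q_{41}&Q_{42}&0&I\end{pmatrix},\qquad \widetilde E:=\widetilde UE\widetilde X=\begin{pmatrix}E_{11}&0&0&0\\E_{21}&E_{22}&0&0\\0&0&I&0\\0&0&0&0\end{pmatrix},$$ $$\widetilde L:=\widetilde UL\widetilde U^\star=\big[L_{ij}\big]_{i,j=1}^4,\qquad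 \widetilde A:=\widetilde ULQ\widetilde X=\begin{pmatrix}A_{11}&0&0&A_{14}\\A_{21}&0&0&A_{24}\\A_{31}&A_{32}&0&A_{34}\\0&0&0&A_{44}\end{pmatrix},$$ where $E_{11}$, $E_{22}$, $A_{11}$, $A_{44}$ and $\begin{pmatrix}Q_{11}&Q_{12}\\Q_{21}&Q_{22}\end{pmatrix}$ are invertible. If zero is an eigenvalue of $P(\lambda)$, i.e. $\operatorname{rank}P(0)<\max_{\alpha\in\mathbb C}\operatorname{rank}P(\alpha)$, then the following conditions are equivalent: (a) zero is a semisimple eigenvalue of $P(\lambda)$, i.e. all Jordan blocks for the eigenvalue $0$ in the Kronecker canonical form of $P(\lambda)$ have size one; (b) $A_{32}=0$; (c) $\operatorname{im}\begin{pmatrix}Q_{12}\\Q_{22}\\0\\Q_{42}\end{pmatrix}\subseteq\ker\begin{pmatrix}L_{31}&L_{32}&0&L_{34}\end{pmatrix}$. If zero is not an eigenvalue of $P(\lambda)$, then (b) and (c) hold. -/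

import Mathlib

open scoped ComplexOrder

namespace PHPencil

/-! ### Matrix pencils `λ E - A` over `ℂ` -/

section Pencils

variable {m n : ℕ}

/-- The pencil `λ E - A` is regular: `det (λ₀ E - A) ≠ 0` for some `λ₀ ∈ ℂ`. -/
def IsRegular (E A : Matrix (Fin n) (Fin n) ℂ) : Prop :=
  ∃ z : ℂ, (z • E - A).det ≠ 0

/-- The normal rank of `λ E - A`: the maximum over `α ∈ ℂ` of `rank (α E - A)` (the ranks are
bounded by the size of the pencil, so the supremum is attained). -/
noncomputable def normalRank (E A : Matrix (Fin n) (Fin m) ℂ) : ℕ :=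
  ⨆ α : ℂ, (α • E - A).rank

/-- `z` is a finite eigenvalue of `λ E - A`: the rank drops at `z`. -/
def IsEigenvalue (E A : Matrix (Fin n) (Fin m) ℂ) (z : ℂ) : Prop :=
  (z • E - A).rank < normalRank E A

/-- The four types of blocks of the Kronecker canonical form:
`L_ε` (size `ε × (ε + 1)`), its transpose type `L_η^T` (size `(η + 1) × η`), the Jordan block of
size `ρ ≥ 1` for the eigenvalue `z`, and the nilpotent block of size `σ ≥ 1` (belonging to `∞`). -/
inductive KBlock : Type
  | L (ε : ℕ)
  | LT (η : ℕ)
  | J (ρ : ℕ+) (z : ℂ)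
  | N (σ : ℕ+)

namespace KBlock

/-- Number of rows of a block. -/
def rows : KBlock → ℕ
  | L ε => ε
  | LT η => η + 1
  | J ρ _ => ρ
  | N σ => σ

/-- Number of columns of a block. -/
def cols : KBlock → ℕ
  | L ε => ε + 1
  | LT η => η
  | J ρ _ => ρ
  | N σ => σ

/-- The coefficient of `λ` in a block `λ E - A`. -/
def matE : (b : KBlock) → Matrix (Fin b.rows) (Fin b.cols) ℂ
  | L ε => Matrix.of fun (i : Fin ε) (j : Fin (ε + 1)) => if (j : ℕ) = i then 1 else 0
  | LT η => Matrix.of fun (i : Fin (η + 1)) (j : Fin η) => if (i : ℕ) = j then 1 else 0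
  | J ρ _ => (1 : Matrix (Fin ρ) (Fin ρ) ℂ)
  | N σ => Matrix.of fun (i j : Fin σ) => if (j : ℕ) = i + 1 then 1 else 0

/-- The matrix `A` in a block `λ E - A`. -/
def matA : (b : KBlock) → Matrix (Fin b.rows) (Fin b.cols) ℂ
  | L ε => Matrix.of fun (i : Fin ε) (j : Fin (ε + 1)) => if (j : ℕ) = i + 1 then 1 else 0
  | LT η => Matrix.of fun (i : Fin (η + 1)) (j : Fin η) => if (i : ℕ) = j + 1 then 1 else 0
  | J ρ z => Matrix.of fun (i j : Fin ρ) =>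
      if (j : ℕ) = i then z else if (j : ℕ) = i + 1 then 1 else 0
  | N σ => (1 : Matrix (Fin σ) (Fin σ) ℂ)

/-- Size of a nilpotent block; `0` for the other types. -/
def nilSize : KBlock → ℕ
  | N σ => σ
  | _ => 0

end KBlock

/-- The block diagonal pencil with blocks `b 0, …, b (k - 1)` is a Kronecker canonical form of
`λ E - A`: there are nonsingular `S`, `T` with `S (λ E - A) T = diag (b 0, …, b (k - 1))`. The
bijections `e`, `f` only number the rows and columns of the block diagonal matrix. -/
def IsKroneckerForm (E A : Matrix (Fin n) (Fin m) ℂ) {k : ℕ} (b : Fin k → KBlock) : Prop :=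
  ∃ (e : (Σ i, Fin (b i).rows) ≃ Fin n) (f : (Σ i, Fin (b i).cols) ≃ Fin m)
    (S : Matrix (Fin n) (Fin n) ℂ) (T : Matrix (Fin m) (Fin m) ℂ),
    IsUnit S ∧ IsUnit T ∧
    S * E * T = Matrix.reindex e f (Matrix.blockDiagonal' fun i => (b i).matE) ∧
    S * A * T = Matrix.reindex e f (Matrix.blockDiagonal' fun i => (b i).matA)

/-- `λ E - A` has index `ν`: the largest nilpotent block of its Kronecker canonical form has size
`ν`, with `ν = 0` if there is none. (The canonical form is unique up to the order of the
blocks.) -/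
def HasIndex (E A : Matrix (Fin n) (Fin m) ℂ) (ν : ℕ) : Prop :=
  ∃ (k : ℕ) (b : Fin k → KBlock), IsKroneckerForm E A b ∧
    (Finset.univ.sup fun i => (b i).nilSize) = ν

/-- `z` is a semisimple eigenvalue of `λ E - A`: it is an eigenvalue, and all the Jordan blocks
with eigenvalue `z` in the Kronecker canonical form have size one. -/
def IsSemisimpleEigenvalue (E A : Matrix (Fin n) (Fin m) ℂ) (z : ℂ) : Prop :=
  IsEigenvalue E A z ∧
    ∃ (k : ℕ) (b : Fin k → KBlock), IsKroneckerForm E A b ∧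
      ∀ (i : Fin k) (ρ : ℕ+), b i = KBlock.J ρ z → ρ = 1

end Pencils

/-! ### The condensed form -/

section CondensedForm

variable {𝕜 : Type*} [RCLike 𝕜] {n : ℕ} {ν : Fin 4 → ℕ}

/-- A matrix over `𝕜 = ℝ` or `ℂ`, regarded as a complex matrix. -/
noncomputable def toC {m : ℕ} (M : Matrix (Fin n) (Fin m) 𝕜) : Matrix (Fin n) (Fin m) ℂ :=
  M.map (RCLike.map 𝕜 ℂ)

/-- The `(i, j)` block of `M` partitioned conformably with the partition
`n = ν 0 + ν 1 + ν 2 + ν 3` into consecutive rows and columns. Blocks are numbered from `0`, so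
the block usually written `M₃₂` is `blk hν M 2 1`. -/
def blk (hν : ∑ i, ν i = n) (M : Matrix (Fin n) (Fin n) 𝕜) (i j : Fin 4) :
    Matrix (Fin (ν i)) (Fin (ν j)) 𝕜 :=
  M.submatrix (fun a => Fin.cast hν (finSigmaFinEquiv ⟨i, a⟩))
    (fun a => Fin.cast hν (finSigmaFinEquiv ⟨j, a⟩))

/-- `U`, `X` and the partition `ν` bring `(E, Q, L)` to the condensed form
```
        Q₁₁ Q₁₂ 0 0           E₁₁ 0   0 0             A₁₁ 0   0 A₁₄
U Q X = Q₂₁ Q₂₂ 0 0   U E X = E₂₁ E₂₂ 0 0   U L Q X = A₂₁ 0   0 A₂₄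
        0   0   0 0           0   0   I 0             A₃₁ A₃₂ 0 A₃₄
        Q₄₁ Q₄₂ 0 I           0   0   0 0             0   0   0 A₄₄
```
with `U` unitary, `X` invertible, and `E₁₁`, `E₂₂`, `A₁₁`, `A₄₄`, `[Q₁₁ Q₁₂; Q₂₁ Q₂₂]`
invertible. Triangularity of `E₁₁`, `E₂₂`, `A₁₁`, which can be achieved in addition over `ℂ`,
is not demanded. -/
structure IsCondensedForm (E Q L U X : Matrix (Fin n) (Fin n) 𝕜) (hν : ∑ i, ν i = n) :
    Prop where
  unitary_U : U ∈ Matrix.unitaryGroup (Fin n) 𝕜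
  isUnit_X : IsUnit X
  -- zero and identity blocks of `U Q X`
  Q13 : blk hν (U * Q * X) 0 2 = 0
  Q14 : blk hν (U * Q * X) 0 3 = 0
  Q23 : blk hν (U * Q * X) 1 2 = 0
  Q24 : blk hν (U * Q * X) 1 3 = 0
  Q31 : blk hν (U * Q * X) 2 0 = 0
  Q32 : blk hν (U * Q * X) 2 1 = 0
  Q33 : blk hν (U * Q * X) 2 2 = 0
  Q34 : blk hν (U * Q * X) 2 3 = 0
  Q43 : blk hν (U * Q * X) 3 2 = 0
  Q44 : blk hν (U * Q * X) 3 3 = 1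
  -- zero and identity blocks of `U E X`
  E12 : blk hν (U * E * X) 0 1 = 0
  E13 : blk hν (U * E * X) 0 2 = 0
  E14 : blk hν (U * E * X) 0 3 = 0
  E23 : blk hν (U * E * X) 1 2 = 0
  E24 : blk hν (U * E * X) 1 3 = 0
  E31 : blk hν (U * E * X) 2 0 = 0
  E32 : blk hν (U * E * X) 2 1 = 0
  E33 : blk hν (U * E * X) 2 2 = 1
  E34 : blk hν (U * E * X) 2 3 = 0
  E41 : blk hν (U * E * X) 3 0 = 0
  E42 : blk hν (U * E * X) 3 1 = 0
  E43 : blk hν (U * E * X) 3 2 = 0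
  E44 : blk hν (U * E * X) 3 3 = 0
  -- zero blocks of `U L Q X`
  A12 : blk hν (U * L * Q * X) 0 1 = 0
  A13 : blk hν (U * L * Q * X) 0 2 = 0
  A22 : blk hν (U * L * Q * X) 1 1 = 0
  A23 : blk hν (U * L * Q * X) 1 2 = 0
  A33 : blk hν (U * L * Q * X) 2 2 = 0
  A41 : blk hν (U * L * Q * X) 3 0 = 0
  A42 : blk hν (U * L * Q * X) 3 1 = 0
  A43 : blk hν (U * L * Q * X) 3 2 = 0
  -- invertible blocks
  isUnit_E11 : IsUnit (blk hν (U * E * X) 0 0)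
  isUnit_E22 : IsUnit (blk hν (U * E * X) 1 1)
  isUnit_A11 : IsUnit (blk hν (U * L * Q * X) 0 0)
  isUnit_A44 : IsUnit (blk hν (U * L * Q * X) 3 3)
  isUnit_Q : IsUnit (Matrix.fromBlocks
    (blk hν (U * Q * X) 0 0) (blk hν (U * Q * X) 0 1)
    (blk hν (U * Q * X) 1 0) (blk hν (U * Q * X) 1 1))

/-- The block column `[Q₁₂; Q₂₂; 0; Q₄₂]` of a partitioned matrix `Q`. -/
def colQ2 (hν : ∑ i, ν i = n) (Q : Matrix (Fin n) (Fin n) 𝕜) :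
    Matrix (Fin (ν 0) ⊕ Fin (ν 1) ⊕ Fin (ν 2) ⊕ Fin (ν 3)) (Fin (ν 1)) 𝕜 :=
  Matrix.fromRows (blk hν Q 0 1) (Matrix.fromRows (blk hν Q 1 1)
    (Matrix.fromRows (0 : Matrix (Fin (ν 2)) (Fin (ν 1)) 𝕜) (blk hν Q 3 1)))

/-- The block row `[L₃₁ L₃₂ 0 L₃₄]` of a partitioned matrix `L`. -/
def rowL3 (hν : ∑ i, ν i = n) (L : Matrix (Fin n) (Fin n) 𝕜) :
    Matrix (Fin (ν 2)) (Fin (ν 0) ⊕ Fin (ν 1) ⊕ Fin (ν 2) ⊕ Fin (ν 3)) 𝕜 :=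
  Matrix.fromCols (blk hν L 2 0) (Matrix.fromCols (blk hν L 2 1)
    (Matrix.fromCols (0 : Matrix (Fin (ν 2)) (Fin (ν 2)) 𝕜) (blk hν L 2 3)))

end CondensedForm

end PHPencil

/-! Write `A = L Q`. For a regular pencil, zero has only Jordan blocks of size one exactly when
there is no chain `A x = 0`, `A y = E x` with `E x ≠ 0` (`NoZeroChain`). This condition is invariant
under equivalence `S (λ E - A) T`, so it can be evaluated in two normal forms.

In a Kronecker form it splits over the blocks. It holds trivially where `A` is injective (nilpotent
blocks, `L_η^T`, Jordan blocks at `z ≠ 0`), and for a Jordan block at zero it says that the size is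
one. The blocks `L_ε` are excluded by regularity.

In the condensed form, invertibility of `A₁₁` and `A₄₄` gives any chain `x₁ = x₄ = 0`, then `y₁ = y₄
= 0` and `E x = (0, 0, A₃₂ y₂, 0)`. Conversely every vector `A₃₂ w` arises from a chain. Hence the
condition is `A₃₂ = 0` (`IsCondensedForm.noZeroChain_iff`).

Condition (c) says that a product of a block row and a block column vanishes, and that product is
`A₃₂`. If zero is not an eigenvalue, `A` has trivial kernel and there is no chain to exclude. -/

namespace PHPencil

open Matrix

/-! ### Chains at the eigenvalue zero -/

section Chains

variable {m m' n n' : Type*} [Fintype n] [Fintype n']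

/-- The pencil `λ E - A` has no Jordan chain of length two at zero. -/
def NoZeroChain (E A : Matrix m n ℂ) : Prop :=
  ∀ x y, A *ᵥ x = 0 → A *ᵥ y = E *ᵥ x → E *ᵥ x = 0

/-- Injectivity of `S` cancels it from each equation; surjectivity of `T` makes the substitution `x
↦ T x`, `y ↦ T y` exhaust all pairs. -/
theorem noZeroChain_mul_iff [Fintype m] [DecidableEq m] [DecidableEq n] {E A : Matrix m n ℂ}
    {S : Matrix m m ℂ} {T : Matrix n n ℂ} (hS : IsUnit S) (hT : IsUnit T) :
    NoZeroChain (S * E * T) (S * A * T) ↔ NoZeroChain E A := by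
  have hS' := mulVec_injective_of_isUnit hS
  have hS0 : ∀ v, S *ᵥ v = 0 ↔ v = 0 := fun v =>
    ⟨fun h => hS' (by simpa using h), fun h => by simp [h]⟩
  have hsurj : ∀ w, ∃ v, T *ᵥ v = w := by
    obtain ⟨T', rfl⟩ := hT
    exact fun w => ⟨(↑T'⁻¹ : Matrix n n ℂ) *ᵥ w, by simp [mulVec_mulVec]⟩
  simp only [NoZeroChain, ← mulVec_mulVec, hS0, hS'.eq_iff]
  constructor
  · intro h x y hx hy
    obtain ⟨x, rfl⟩ := hsurj x
    obtain ⟨y, rfl⟩ := hsurj y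
    exact h x y hx hy
  · exact fun h x y => h (T *ᵥ x) (T *ᵥ y)

theorem reindex_mulVec_comp_symm (e : m ≃ m') (f : n ≃ n') (M : Matrix m n ℂ) (v : n → ℂ) :
    reindex e f M *ᵥ (v ∘ f.symm) = (M *ᵥ v) ∘ e.symm := by
  rw [reindex_apply, submatrix_mulVec_equiv]
  simp [Function.comp_assoc]

theorem noZeroChain_reindex_iff (e : m ≃ m') (f : n ≃ n') {E A : Matrix m n ℂ} :
    NoZeroChain (reindex e f E) (reindex e f A) ↔ NoZeroChain E A := by
  have hinj : Function.Injective fun v : m → ℂ => v ∘ e.symm :=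
    e.symm.surjective.injective_comp_right
  have h0 : ∀ v : m → ℂ, v ∘ e.symm = 0 ↔ v = 0 := fun v =>
    ⟨fun h => hinj (by simpa using h), fun h => by simp [h]⟩
  have hv : ∀ v : n' → ℂ, ∃ w : n → ℂ, w ∘ f.symm = v := fun v => ⟨v ∘ f, by
    simp [Function.comp_assoc]⟩
  constructor
  · intro h x y hx hy
    have := h (x ∘ f.symm) (y ∘ f.symm)
    simp only [reindex_mulVec_comp_symm, h0] at this
    exact this hx (by rw [hy])
  · intro h x y
    obtain ⟨x, rfl⟩ := hv x
    obtain ⟨y, rfl⟩ := hv y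
    simp only [reindex_mulVec_comp_symm, h0]
    exact fun hx hy => h x y hx (hinj hy)

end Chains

/-! ### Chains in block diagonal pencils -/

section BlockDiagonal

theorem exists_sigma_extension {ι : Type*} [DecidableEq ι] {c : ι → Type*} (i : ι) (x : c i → ℂ) :
    ∃ v : (Σ i, c i) → ℂ, (fun b => v ⟨i, b⟩) = x ∧ ∀ j ≠ i, (fun b => v ⟨j, b⟩) = 0 := by
  refine ⟨fun p => (Pi.single i x : ∀ j, c j → ℂ) p.1 p.2, by simp, fun j hj => ?_⟩
  simp only [Pi.single_eq_of_ne hj]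

variable {ι : Type*} [Fintype ι] [DecidableEq ι] {r c : ι → Type*} [∀ i, Fintype (c i)]

theorem blockDiagonal'_mulVec_apply (M : ∀ i, Matrix (r i) (c i) ℂ) (v : (Σ i, c i) → ℂ)
    (i : ι) (a : r i) :
    (blockDiagonal' M *ᵥ v) ⟨i, a⟩ = (M i *ᵥ fun b => v ⟨i, b⟩) a := by
  simp only [mulVec, dotProduct, Fintype.sum_sigma]
  rw [Finset.sum_eq_single i]
  · simp
  · intro j _ hj
    refine Finset.sum_eq_zero fun b _ => ?_
    rw [blockDiagonal'_apply_ne _ _ _ (Ne.symm hj), zero_mul]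
  · simp

theorem blockDiagonal'_mulVec_eq_iff (M N : ∀ i, Matrix (r i) (c i) ℂ)
    (v w : (Σ i, c i) → ℂ) :
    blockDiagonal' M *ᵥ v = blockDiagonal' N *ᵥ w ↔
      ∀ i, (M i *ᵥ fun b => v ⟨i, b⟩) = N i *ᵥ fun b => w ⟨i, b⟩ := by
  constructor
  · intro h i
    ext a
    simpa [blockDiagonal'_mulVec_apply] using congrFun h ⟨i, a⟩
  · intro h
    ext ⟨i, a⟩
    simpa [blockDiagonal'_mulVec_apply] using congrFun (h i) a

theorem blockDiagonal'_mulVec_eq_zero_iff (M : ∀ i, Matrix (r i) (c i) ℂ)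
    (v : (Σ i, c i) → ℂ) :
    blockDiagonal' M *ᵥ v = 0 ↔ ∀ i, (M i *ᵥ fun b => v ⟨i, b⟩) = 0 := by
  simpa [← Pi.zero_def] using blockDiagonal'_mulVec_eq_iff M M v 0

/-- The chain equations decouple into components, and a chain in one block extends by zero to a
chain of the whole pencil. -/
theorem noZeroChain_blockDiagonal'_iff (E A : ∀ i, Matrix (r i) (c i) ℂ) :
    NoZeroChain (blockDiagonal' E) (blockDiagonal' A) ↔ ∀ i, NoZeroChain (E i) (A i) := by
  simp only [NoZeroChain, blockDiagonal'_mulVec_eq_iff, blockDiagonal'_mulVec_eq_zero_iff]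
  constructor
  · intro h i x y hx hy
    obtain ⟨x, rfl, hx'⟩ := exists_sigma_extension i x
    obtain ⟨y, rfl, hy'⟩ := exists_sigma_extension i y
    refine h x y (fun j => ?_) (fun j => ?_) i
    all_goals
      by_cases hj : j = i
      · subst hj; assumption
      · simp [hx' j hj, hy' j hj]
  · exact fun h x y hx hy i => h i _ _ (hx i) (hy i)

end BlockDiagonal

/-! ### Kronecker blocks -/

namespace KBlock

theorem noZeroChain_J_zero_iff (ρ : ℕ+) :
    NoZeroChain (J ρ 0).matE (J ρ 0).matA ↔ ρ = 1 := by
  change NoZeroChain (1 : Matrix (Fin ρ) (Fin ρ) ℂ) (of fun (i j : Fin ρ) =>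
      if (j : ℕ) = i then 0 else if (j : ℕ) = i + 1 then 1 else 0) ↔ ρ = 1
  constructor
  · intro h
    by_contra hρ
    have h2 : 1 < (ρ : ℕ) := by
      have := ρ.pos
      have : (ρ : ℕ) ≠ 1 := fun h => hρ (PNat.coe_eq_one_iff.mp h)
      omega
    -- The first two unit vectors form a chain: `A e₀ = 0` and `A e₁ = e₀ = E e₀ ≠ 0`.
    have := h (Pi.single ⟨0, ρ.pos⟩ 1) (Pi.single ⟨1, h2⟩ 1) (by
      ext i; simp) (by
      ext i
      by_cases hi : (i : ℕ) = 0
      · obtain rfl : i = ⟨0, ρ.pos⟩ := Fin.ext hi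
        simp
      · simp [Fin.ext_iff, hi])
    simpa using congrFun this ⟨0, ρ.pos⟩
  · rintro rfl x y - hy
    have hA : (of fun (i j : Fin (1 : ℕ+)) =>
        if (j : ℕ) = i then (0 : ℂ) else if (j : ℕ) = i + 1 then 1 else 0) = 0 := by
      ext i j
      have hi : (i : ℕ) < 1 := i.isLt
      have hj : (j : ℕ) < 1 := j.isLt
      rw [of_apply, if_pos (by omega), Matrix.zero_apply]
    rw [← hy, hA, zero_mulVec]

theorem isUnit_matA_J (ρ : ℕ+) {z : ℂ} (hz : z ≠ 0) :
    IsUnit (of fun (i j : Fin ρ) =>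
      if (j : ℕ) = i then z else if (j : ℕ) = i + 1 then 1 else 0) := by
  rw [isUnit_iff_isUnit_det, det_of_isUpperTriangular]
  · simp [hz]
  · intro i j hij
    have : (j : ℕ) < i := hij
    simp [show (j : ℕ) ≠ i by omega, show (j : ℕ) ≠ i + 1 by omega]

theorem noZeroChain_J_of_ne_zero (ρ : ℕ+) {z : ℂ} (hz : z ≠ 0) :
    NoZeroChain (J ρ z).matE (J ρ z).matA := by
  intro x y hx _
  have : x = 0 := mulVec_injective_of_isUnit (isUnit_matA_J ρ hz) (hx.trans (mulVec_zero _).symm)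
  simp [this]

theorem noZeroChain_N (σ : ℕ+) : NoZeroChain (N σ).matE (N σ).matA := by
  intro x y hx _
  have : x = 0 := (one_mulVec x).symm.trans hx
  simp [this]

theorem eq_zero_of_matA_LT_mulVec {η : ℕ} {x : Fin η → ℂ} (hx : (LT η).matA *ᵥ x = 0) :
    x = 0 := by
  ext i
  -- Row `i + 1` has its only nonzero entry in column `i`, so it reads off `x i`.
  have h : ∑ j : Fin η, (if (i.succ : ℕ) = j + 1 then (1 : ℂ) else 0) * x j = 0 :=
    congrFun hx i.succ
  simpa [Fin.val_inj] using h

theorem noZeroChain_LT (η : ℕ) : NoZeroChain (LT η).matE (LT η).matA := by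
  intro x y hx _
  rw [eq_zero_of_matA_LT_mulVec hx]
  exact mulVec_zero _

/-- The block has one more column than rows, so it has a kernel at every `z`. -/
theorem exists_ker_L (ε : ℕ) (z : ℂ) : ∃ v ≠ 0, (z • (L ε).matE - (L ε).matA) *ᵥ v = 0 := by
  have h : LinearMap.ker (z • (L ε).matE - (L ε).matA).mulVecLin ≠ ⊥ :=
    LinearMap.ker_ne_bot_of_finrank_lt (by
      change Module.finrank ℂ (Fin (ε + 1) → ℂ) > Module.finrank ℂ (Fin ε → ℂ)
      simp)
  obtain ⟨v, hv, hv0⟩ := Submodule.exists_mem_ne_zero_of_ne_bot h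
  exact ⟨v, hv0, hv⟩

end KBlock

/-! ### Reading the eigenvalue zero off a Kronecker form -/

section Kronecker

variable {n : ℕ} {E A : Matrix (Fin n) (Fin n) ℂ} {k : ℕ} {b : Fin k → KBlock}

theorem IsKroneckerForm.noZeroChain_iff (hb : IsKroneckerForm E A b) :
    NoZeroChain E A ↔ ∀ i, NoZeroChain (b i).matE (b i).matA := by
  obtain ⟨e, f, S, T, hS, hT, hE, hA⟩ := hb
  rw [← noZeroChain_mul_iff hS hT, hE, hA, noZeroChain_reindex_iff,
    noZeroChain_blockDiagonal'_iff]

/-- The Kronecker form of a regular pencil has no blocks `L_ε`. -/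
theorem IsKroneckerForm.ne_L (hb : IsKroneckerForm E A b) (hreg : IsRegular E A) (i : Fin k)
    (ε : ℕ) : b i ≠ KBlock.L ε := by
  intro hi
  obtain ⟨z, hz⟩ := hreg
  obtain ⟨e, f, S, T, hS, hT, hE, hA⟩ := hb
  have hker : ∃ v ≠ 0, (z • (b i).matE - (b i).matA) *ᵥ v = 0 := by
    rw [hi]; exact KBlock.exists_ker_L ε z
  obtain ⟨v, hv0, hv⟩ := hker
  -- Extended by zero, the kernel vector of the single block is annihilated by the whole pencil at
  -- `z`, which is invertible there.
  obtain ⟨w, rfl, hw⟩ := exists_sigma_extension (c := fun i => Fin (b i).cols) i v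
  have hM : S * (z • E - A) * T = reindex e f
      (blockDiagonal' fun i => z • (b i).matE - (b i).matA) := by
    have : (blockDiagonal' fun i => z • (b i).matE - (b i).matA) =
        z • (blockDiagonal' fun i => (b i).matE) - blockDiagonal' fun i => (b i).matA := by
      rw [← blockDiagonal'_smul, ← blockDiagonal'_sub]; rfl
    rw [this, mul_sub, sub_mul, mul_smul_comm, smul_mul_assoc, hE, hA]
    rfl
  have h0 : (S * (z • E - A) * T) *ᵥ (w ∘ f.symm) = 0 := by
    rw [hM, reindex_mulVec_comp_symm, (blockDiagonal'_mulVec_eq_zero_iff _ w).2]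
    · rfl
    · intro j
      by_cases hj : j = i
      · subst hj; exact hv
      · rw [hw j hj, mulVec_zero]
  have hu : IsUnit (S * (z • E - A) * T) :=
    (hS.mul ((isUnit_iff_isUnit_det _).2 hz.isUnit)).mul hT
  have hwf : w ∘ f.symm = 0 := mulVec_injective_of_isUnit hu (h0.trans (mulVec_zero _).symm)
  refine hv0 (funext fun a => ?_)
  simpa using congrFun hwf (f ⟨i, a⟩)

/-- For a regular pencil, the absence of chains of length two at zero means that the Jordan blocks
at zero of any Kronecker form have size one. -/
theorem IsKroneckerForm.noZeroChain_iff_forall_eq_one (hb : IsKroneckerForm E A b)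
    (hreg : IsRegular E A) :
    NoZeroChain E A ↔ ∀ (i : Fin k) (ρ : ℕ+), b i = KBlock.J ρ 0 → ρ = 1 := by
  rw [hb.noZeroChain_iff]
  constructor
  · intro h i ρ hi
    have := h i
    rw [hi] at this
    exact (KBlock.noZeroChain_J_zero_iff ρ).1 this
  · intro h i
    have hL := hb.ne_L hreg i
    have hJ := h i
    generalize b i = B at hL hJ
    cases B with
    | L ε => exact absurd rfl (hL ε)
    | LT η => exact KBlock.noZeroChain_LT η
    | N σ => exact KBlock.noZeroChain_N σ
    | J ρ z =>
      by_cases hz : z = 0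
      · subst hz
        exact (KBlock.noZeroChain_J_zero_iff ρ).2 (hJ ρ rfl)
      · exact KBlock.noZeroChain_J_of_ne_zero ρ hz

/-- Absence of chains does not depend on the chosen form, so uniqueness of the Kronecker form is not
needed. The given form `b` serves as the witness in the reverse direction. -/
theorem isSemisimpleEigenvalue_zero_iff (hreg : IsRegular E A) (hb : IsKroneckerForm E A b) :
    IsSemisimpleEigenvalue E A 0 ↔ IsEigenvalue E A 0 ∧ NoZeroChain E A := by
  refine and_congr_right fun _ => ⟨?_, fun h => ?_⟩
  · rintro ⟨k, b, hb, h⟩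
    exact (hb.noZeroChain_iff_forall_eq_one hreg).2 h
  · exact ⟨k, b, hb, (hb.noZeroChain_iff_forall_eq_one hreg).1 h⟩

/-- If zero is not an eigenvalue of the regular pencil `λ E - A`, then `A` has trivial kernel. -/
theorem eq_zero_of_not_isEigenvalue_zero (hreg : IsRegular E A) (h0 : ¬ IsEigenvalue E A 0)
    {x : Fin n → ℂ} (hx : A *ᵥ x = 0) : x = 0 := by
  obtain ⟨z, hz⟩ := hreg
  -- Boundedness makes the supremum in `normalRank` genuine: in `ℕ` an unbounded one would take the
  -- default value `0`.
  have hbdd : BddAbove (Set.range fun α : ℂ => (α • E - A).rank) :=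
    ⟨n, by rintro _ ⟨α, rfl⟩; exact rank_le_width _⟩
  have hz' : (z • E - A).rank = n := by
    simpa using rank_of_isUnit _ ((isUnit_iff_isUnit_det _).2 hz.isUnit)
  have hn : n ≤ ((0 : ℂ) • E - A).rank := by
    have := le_ciSup hbdd z
    exact (hz'.symm.le.trans this).trans (not_lt.1 h0)
  have hker := LinearMap.finrank_range_add_finrank_ker ((0 : ℂ) • E - A).mulVecLin
  rw [← rank, Module.finrank_fin_fun] at hker
  have hbot : LinearMap.ker ((0 : ℂ) • E - A).mulVecLin = ⊥ :=
    Submodule.finrank_eq_zero.1 (by omega)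
  have hmem : x ∈ LinearMap.ker ((0 : ℂ) • E - A).mulVecLin := by
    simp [hx]
  rwa [hbot, Submodule.mem_bot] at hmem

end Kronecker

/-! ### Partitioned matrices and vectors -/

section Partition

/-- The position of the index `a` of the `i`-th part. -/
def partEquiv {n : ℕ} {ν : Fin 4 → ℕ} (hν : ∑ i, ν i = n) : (Σ i, Fin (ν i)) ≃ Fin n :=
  finSigmaFinEquiv.trans (finCongr hν)

/-- The `i`-th part of a partitioned vector. -/
def part {α : Type*} {n : ℕ} {ν : Fin 4 → ℕ} (hν : ∑ i, ν i = n) (v : Fin n → α)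
    (i : Fin 4) : Fin (ν i) → α :=
  fun a => v (partEquiv hν ⟨i, a⟩)

theorem part_ext_iff {α : Type*} {n : ℕ} {ν : Fin 4 → ℕ} (hν : ∑ i, ν i = n) {v w : Fin n → α} :
    v = w ↔ ∀ i, part hν v i = part hν w i := by
  refine ⟨fun h i => by rw [h], fun h => ?_⟩
  ext a
  obtain ⟨⟨i, a⟩, rfl⟩ := (partEquiv hν).surjective a
  exact congrFun (h i) a

theorem exists_part_eq {α : Type*} {n : ℕ} {ν : Fin 4 → ℕ} (hν : ∑ i, ν i = n)
    (w : ∀ i, Fin (ν i) → α) :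
    ∃ v : Fin n → α, part hν v = w :=
  ⟨fun a => w ((partEquiv hν).symm a).1 ((partEquiv hν).symm a).2, by
    ext i a
    simp only [part]
    rw [Equiv.symm_apply_apply]⟩

variable {𝕜 : Type*} [RCLike 𝕜] {n : ℕ} {ν : Fin 4 → ℕ}

variable (𝕜) in
/-- The embedding of `𝕜 = ℝ` or `ℂ` into `ℂ` as a ring homomorphism. -/
noncomputable def mapHom : 𝕜 →+* ℂ where
  toFun := RCLike.map 𝕜 ℂ
  map_zero' := map_zero _
  map_add' := map_add _
  map_one' := by simp
  map_mul' x y := by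
    apply Complex.ext <;> simp [RCLike.mul_re, RCLike.mul_im]

theorem toC_mul (M N : Matrix (Fin n) (Fin n) 𝕜) : toC (M * N) = toC M * toC N :=
  Matrix.map_mul (f := mapHom 𝕜)

theorem isUnit_map_mapHom {m : ℕ} {M : Matrix (Fin m) (Fin m) 𝕜} (hM : IsUnit M) :
    IsUnit (M.map (mapHom 𝕜)) :=
  hM.map (mapHom 𝕜).mapMatrix

theorem blk_toC (hν : ∑ i, ν i = n) (M : Matrix (Fin n) (Fin n) 𝕜) (i j : Fin 4) :
    blk hν (toC M) i j = (blk hν M i j).map (mapHom 𝕜) := rfl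

theorem map_mapHom_eq_zero_iff {p q : ℕ} {M : Matrix (Fin p) (Fin q) 𝕜} :
    M.map (mapHom 𝕜) = 0 ↔ M = 0 := by
  constructor
  · intro h
    ext i j
    simpa using congrFun (congrFun h i) j
  · rintro rfl
    simp

theorem blk_mul (hν : ∑ i, ν i = n) (M N : Matrix (Fin n) (Fin n) 𝕜) (i j : Fin 4) :
    blk hν (M * N) i j = ∑ l, blk hν M i l * blk hν N l j := by
  ext a b
  rw [Matrix.sum_apply]
  simp only [blk, submatrix_apply, mul_apply]
  rw [← (partEquiv hν).sum_comp, Fintype.sum_sigma]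
  rfl

theorem part_mulVec (hν : ∑ i, ν i = n) (M : Matrix (Fin n) (Fin n) 𝕜) (v : Fin n → 𝕜)
    (i : Fin 4) : part hν (M *ᵥ v) i = ∑ j, blk hν M i j *ᵥ part hν v j := by
  ext a
  rw [Finset.sum_apply]
  simp only [part, mulVec, dotProduct]
  rw [← (partEquiv hν).sum_comp, Fintype.sum_sigma]
  rfl

@[simp]
theorem part_zero (hν : ∑ i, ν i = n) (i : Fin 4) : part hν (0 : Fin n → 𝕜) i = 0 := rfl

end Partition

/-! ### The condensed form -/

section CondensedForm

variable {𝕜 : Type*} [RCLike 𝕜] {n : ℕ} {ν : Fin 4 → ℕ} {hν : ∑ i, ν i = n}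
  {E Q L U X : Matrix (Fin n) (Fin n) 𝕜}

/-- Inserting `Uᴴ U = 1` factors `U L Q X` as `(U L Uᴴ) (U Q X)`. In its block `(3, 2)` the summand
`L₃₃ Q₃₂` drops out because `Q₃₂ = 0`, which is why zeros may stand in the third places of row and
column. -/
theorem IsCondensedForm.rowL3_mul_colQ2 (h : IsCondensedForm E Q L U X hν) :
    rowL3 hν (U * L * U.conjTranspose) * colQ2 hν (U * Q * X) = blk hν (U * L * Q * X) 2 1 := by
  have hU : U.conjTranspose * U = 1 := mem_unitaryGroup_iff'.1 h.unitary_U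
  have hA : U * L * Q * X = (U * L * U.conjTranspose) * (U * Q * X) := by
    calc U * L * Q * X = U * L * 1 * Q * X := by rw [mul_one]
      _ = _ := by rw [← hU]; simp only [Matrix.mul_assoc]
  rw [hA, blk_mul, Fin.sum_univ_four, h.Q32]
  simp only [rowL3, colQ2, fromCols_mul_fromRows, Matrix.mul_zero]
  abel

theorem IsCondensedForm.A32_eq_zero_iff (h : IsCondensedForm E Q L U X hν) :
    blk hν (U * L * Q * X) 2 1 = 0 ↔
      LinearMap.range (colQ2 hν (U * Q * X)).mulVecLin ≤
        LinearMap.ker (rowL3 hν (U * L * U.conjTranspose)).mulVecLin := by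
  rw [LinearMap.range_le_ker_iff, ← mulVecLin_mul, h.rowL3_mul_colQ2]
  constructor
  · intro h0; rw [h0]; exact mulVecLin_zero
  · intro h0
    refine mulVec_injective (funext fun v => ?_)
    simpa using LinearMap.congr_fun h0 v

theorem IsCondensedForm.isUnit_U (h : IsCondensedForm E Q L U X hν) : IsUnit U :=
  (isUnit_iff_exists).2 ⟨_, mem_unitaryGroup_iff.1 h.unitary_U, mem_unitaryGroup_iff'.1 h.unitary_U⟩

/-- A vector that `U L Q X` maps to zero in the first and last parts vanishes in these parts, and its
image lies in the third part. -/
theorem IsCondensedForm.part_A_mulVec (h : IsCondensedForm E Q L U X hν) (v : Fin n → ℂ)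
    (hv : part hν (toC (U * L * Q * X) *ᵥ v) 0 = 0)
    (hv' : part hν (toC (U * L * Q * X) *ᵥ v) 3 = 0) :
    part hν v 0 = 0 ∧ part hν v 3 = 0 ∧
    part hν (toC (U * L * Q * X) *ᵥ v) 1 = 0 ∧
    part hν (toC (U * L * Q * X) *ᵥ v) 2 =
      (blk hν (U * L * Q * X) 2 1).map (mapHom 𝕜) *ᵥ part hν v 1 := by
  -- The last block row contains only `A₄₄`, so `v₄ = 0` comes first; the first row then reduces to
  -- `A₁₁ v₁ = 0`.
  have h3 : part hν v 3 = 0 := by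
    refine mulVec_injective_of_isUnit (isUnit_map_mapHom h.isUnit_A44) ?_
    simpa [part_mulVec, Fin.sum_univ_four, blk_toC, h.A41, h.A42, h.A43] using hv'
  have h0 : part hν v 0 = 0 := by
    refine mulVec_injective_of_isUnit (isUnit_map_mapHom h.isUnit_A11) ?_
    simpa [part_mulVec, Fin.sum_univ_four, blk_toC, h.A12, h.A13, h3] using hv
  refine ⟨h0, h3, ?_, ?_⟩
  · simp [part_mulVec, Fin.sum_univ_four, blk_toC, h.A22, h.A23, h3, h0]
  · simp [part_mulVec, Fin.sum_univ_four, blk_toC, h.A33, h3, h0]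

theorem IsCondensedForm.part_E_mulVec (h : IsCondensedForm E Q L U X hν) (v : Fin n → ℂ)
    (h0 : part hν v 0 = 0) :
    part hν (toC (U * E * X) *ᵥ v) 0 = 0 ∧
    part hν (toC (U * E * X) *ᵥ v) 1 =
      (blk hν (U * E * X) 1 1).map (mapHom 𝕜) *ᵥ part hν v 1 ∧
    part hν (toC (U * E * X) *ᵥ v) 2 = part hν v 2 ∧
    part hν (toC (U * E * X) *ᵥ v) 3 = 0 := by
  refine ⟨?_, ?_, ?_, ?_⟩ <;>
  simp [part_mulVec, Fin.sum_univ_four, blk_toC, h0, h.E12, h.E13, h.E14, h.E23, h.E24, h.E31,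
    h.E32, h.E33, h.E34, h.E41, h.E42, h.E43, h.E44]

/-- Vectors `(0, w₁, w₂, 0)` meet the hypotheses of `part_A_mulVec` and `part_E_mulVec`; both
members of the chain that detects `A₃₂` have this shape. -/
theorem IsCondensedForm.exists_part (h : IsCondensedForm E Q L U X hν) (w₁ : Fin (ν 1) → ℂ)
    (w₂ : Fin (ν 2) → ℂ) :
    ∃ v : Fin n → ℂ, part hν v 0 = 0 ∧ part hν v 1 = w₁ ∧ part hν v 2 = w₂ ∧
      part hν v 3 = 0 ∧ part hν (toC (U * L * Q * X) *ᵥ v) 0 = 0 ∧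
      part hν (toC (U * L * Q * X) *ᵥ v) 3 = 0 := by
  obtain ⟨v, hv⟩ := exists_part_eq hν
    (Fin.cons 0 (Fin.cons w₁ (Fin.cons w₂ (Fin.cons 0 finZeroElim))) : ∀ i, Fin (ν i) → ℂ)
  have h0 : part hν v 0 = 0 := congrFun hv 0
  have h3 : part hν v 3 = 0 := congrFun hv 3
  refine ⟨v, h0, congrFun hv 1, congrFun hv 2, h3, ?_, ?_⟩
  · simp [part_mulVec, Fin.sum_univ_four, blk_toC, h0, h3, h.A12, h.A13]
  · simp [part_mulVec, Fin.sum_univ_four, blk_toC, h0, h3, h.A41, h.A42, h.A43]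

theorem IsCondensedForm.noZeroChain_iff (h : IsCondensedForm E Q L U X hν) :
    NoZeroChain (toC E) (toC (L * Q)) ↔ blk hν (U * L * Q * X) 2 1 = 0 := by
  rw [← noZeroChain_mul_iff (isUnit_map_mapHom h.isUnit_U) (isUnit_map_mapHom h.isUnit_X)]
  change NoZeroChain (toC U * toC E * toC X) (toC U * toC (L * Q) * toC X) ↔ _
  rw [← toC_mul, ← toC_mul, ← toC_mul, ← toC_mul, ← mul_assoc, ← map_mapHom_eq_zero_iff]
  constructor
  · intro hc
    refine mulVec_injective (funext fun w => ?_)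
    rw [zero_mulVec]
    -- Take `y = (0, w, 0, 0)` and `x = (0, 0, A₃₂ w, 0)`: then `A x = 0` and `A y = x = E x`, so
    -- the absence of chains forces `A₃₂ w = 0`.
    obtain ⟨y, -, hy1, -, -, hA0, hA3⟩ := h.exists_part w 0
    obtain ⟨-, -, hA1, hA2⟩ := h.part_A_mulVec y hA0 hA3
    obtain ⟨x, hx0, hx1, hx2, -, hB0, hB3⟩ := h.exists_part 0
      ((blk hν (U * L * Q * X) 2 1).map (mapHom 𝕜) *ᵥ w)
    obtain ⟨-, -, hB1, hB2⟩ := h.part_A_mulVec x hB0 hB3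
    obtain ⟨hE0, hE1, hE2, hE3⟩ := h.part_E_mulVec x hx0
    have := hc x y ((part_ext_iff hν).2 fun i => ?_) ((part_ext_iff hν).2 fun i => ?_)
    · rw [← hx2, ← hE2, this, part_zero]
    · fin_cases i
      · exact hB0
      · exact hB1
      · exact hB2.trans (by simp [hx1])
      · exact hB3
    · fin_cases i
      · exact hA0.trans hE0.symm
      · exact hA1.trans (by simp [hE1, hx1])
      · exact hA2.trans (by simp [hE2, hx2, hy1])
      · exact hA3.trans hE3.symm
  · intro hA x y hx hy
    -- From `A x = 0` follows `x₁ = 0`, so `E x` vanishes in the first and last parts. As `E x = A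
    -- y`, its second part is zero too and its third is `A₃₂ y₂ = 0`.
    obtain ⟨hx0, -, -, -⟩ := h.part_A_mulVec x (by simp [hx]) (by simp [hx])
    obtain ⟨hE0, -, -, hE3⟩ := h.part_E_mulVec x hx0
    obtain ⟨-, -, h1, h2⟩ := h.part_A_mulVec y (by rw [hy, hE0]) (by rw [hy, hE3])
    rw [hy] at h1 h2
    refine (part_ext_iff hν).2 fun i => ?_
    fin_cases i
    · exact hE0
    · exact h1
    · exact h2.trans (by rw [hA, zero_mulVec]; rfl)
    · exact hE3

theorem IsCondensedForm.A32_eq_zero_of_not_isEigenvalue (h : IsCondensedForm E Q L U X hν)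
    (hreg : IsRegular (toC E) (toC (L * Q))) (h0 : ¬ IsEigenvalue (toC E) (toC (L * Q)) 0) :
    blk hν (U * L * Q * X) 2 1 = 0 := by
  rw [← h.noZeroChain_iff]
  intro x y hx _
  rw [eq_zero_of_not_isEigenvalue_zero hreg h0 hx, mulVec_zero]

end CondensedForm

end PHPencil

open PHPencil in
theorem corollary5p2 {𝕜 : Type*} [RCLike 𝕜] {n : ℕ}
    (E Q L : Matrix (Fin n) (Fin n) 𝕜)
    (hEQ : E.conjTranspose * Q = Q.conjTranspose * E)
    (hEQ_nonneg : (E.conjTranspose * Q).PosSemidef)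
    (hL : (-(L + L.conjTranspose)).PosSemidef)
    (hreg : IsRegular (toC E) (toC (L * Q)))
    (hindex : ∃ d ≤ 1, HasIndex (toC E) (toC (L * Q)) d)
    (ν : Fin 4 → ℕ) (hν : ∑ i, ν i = n)
    (U X : Matrix (Fin n) (Fin n) 𝕜)
    (hform : IsCondensedForm E Q L U X hν) :
    (IsEigenvalue (toC E) (toC (L * Q)) 0 →
      List.TFAE [
        IsSemisimpleEigenvalue (toC E) (toC (L * Q)) 0,
        blk hν (U * L * Q * X) 2 1 = 0,
        LinearMap.range (colQ2 hν (U * Q * X)).mulVecLin ≤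
          LinearMap.ker (rowL3 hν (U * L * U.conjTranspose)).mulVecLin]) ∧
    (¬ IsEigenvalue (toC E) (toC (L * Q)) 0 →
      blk hν (U * L * Q * X) 2 1 = 0 ∧
        LinearMap.range (colQ2 hν (U * Q * X)).mulVecLin ≤
          LinearMap.ker (rowL3 hν (U * L * U.conjTranspose)).mulVecLin) := by
  refine ⟨fun h0 => ?_, fun h0 => ?_⟩
  -- Having an index includes the existence of a Kronecker form, which is what (a) needs.
  · obtain ⟨_, _, _, _, hb, _⟩ := hindex
    tfae_have 1 ↔ 2 := by
      rw [isSemisimpleEigenvalue_zero_iff hreg hb, hform.noZeroChain_iff]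
      exact and_iff_right h0
    tfae_have 2 ↔ 3 := hform.A32_eq_zero_iff
    tfae_finish
  · have h := hform.A32_eq_zero_of_not_isEigenvalue hreg h0
    exact ⟨h, hform.A32_eq_zero_iff.1 h⟩
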